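/- Let $i\ge 0$ be an integer (the critical island size), and consider the gap-size evolution equation $$\frac{\partial}{\partial t}n(x,t)=-B(i+2,i+2)\,x^{2i+3}n(x,t)+2\int_x^\infty x^{i+1}(y-x)^{i+1}n(y,t)\,dy,\qquad x,t>0,$$ where $B$ is the Beta function. Let $\varphi$ be a reduced gap-size distribution for this equation, that is, $\int_0^\infty\varphi(y)\,dy=\int_0^\infty y\varphi(y)\,dy=1$ and there is a nonnegative similarity solution of the equation of the form $$n(x,t)=\frac{N(t)^2}{V}\,\varphi\!\left(\frac{N(t)x}{V}\right),\qquad N(t)=\int_0^\infty n(x,t)\,dx>0,\quad V=\int_0^\infty x\,n(x,t)\,dx>0,$$ with $N$ differentiable and $V$ independent of $t$. Then the one-dimensional capture-zone distribution $P(s)=2\int_0^{2s}\varphi(y)\varphi(2s-y)\,dy$ is well defined for all $s>0$ and satisfies $$P(s)=O(s^{2i+3})\quad\text{as } s\to0^+,$$ and the exponent $2i+3$, which is odd, is exact: also $s^{2i+3}=O(P(s))$ as $s\to0^+$. This contradicts the Generalised Wigner Surmise $$P_\beta(s)=a_\beta s^\beta e^{-b_\beta s^2},\qquad \beta=2(i+1),\quad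 a_\beta=\frac{2\,\Gamma\left(\frac{\beta+2}{2}\right)^{\beta+1}}{\Gamma\left(\frac{\beta+1}{2}\right)^{\beta+2}},\quad b_\beta=\left[\frac{\Gamma\left(\frac{\beta+2}{2}\right)}{\Gamma\left(\frac{\beta+1}{2}\right)}\right]^2,$$ in which the exponent is even: $P(s)=o(P_\beta(s))$ as $s\to0^+$. -/

import Mathlib

open Set Filter Topology MeasureTheory Asymptotics

/-- `n x t`, the number concentration at time `t > 0` of gaps of width `x > 0`, is a (classical,
nonnegative) solution of the gap-size evolution equation with critical island size `i`:
`∂n/∂t (x,t) = - B(i+2,i+2) x^(2i+3) n(x,t) + 2 ∫_x^∞ x^(i+1) (y-x)^(i+1) n(y,t) dy`. -/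
structure IsGapSolution (i : ℕ) (n : ℝ → ℝ → ℝ) : Prop where
  nonneg : ∀ x t : ℝ, 0 < x → 0 < t → 0 ≤ n x t
  integrable : ∀ x t : ℝ, 0 < x → 0 < t →
    IntegrableOn (fun y => x ^ (i + 1) * (y - x) ^ (i + 1) * n y t) (Ioi x)
  evolution : ∀ x t : ℝ, 0 < x → 0 < t →
    HasDerivAt (fun τ => n x τ)
      (-ProbabilityTheory.beta ((i : ℝ) + 2) ((i : ℝ) + 2) * x ^ (2 * i + 3) * n x t
        + 2 * ∫ y in Ioi x, x ^ (i + 1) * (y - x) ^ (i + 1) * n y t) t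

/-- `n` is a similarity solution of the gap-size evolution equation with profile `φ`:
`n(x,t) = N(t)² / V * φ (N(t) x / V)`, where `N(t)` and `V` are the zeroth and the first moment
of `n(·,t)`, the latter (the total length of all gaps) not depending on time. -/
structure IsSimilaritySolution (i : ℕ) (φ : ℝ → ℝ) (n : ℝ → ℝ → ℝ) (N : ℝ → ℝ) (V : ℝ) :
    Prop where
  solution : IsGapSolution i n
  V_pos : 0 < V
  N_pos : ∀ t : ℝ, 0 < t → 0 < N t
  N_differentiable : ∀ t : ℝ, 0 < t → DifferentiableAt ℝ N t
  N_eq : ∀ t : ℝ, 0 < t → N t = ∫ x in Ioi (0 : ℝ), n x t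
  V_eq : ∀ t : ℝ, 0 < t → V = ∫ x in Ioi (0 : ℝ), x * n x t
  similarity : ∀ x t : ℝ, 0 < x → 0 < t → n x t = N t ^ 2 / V * φ (N t * x / V)

/-- `φ` is a reduced gap-size distribution for critical island size `i`: it is normalised to have
total mass and mean equal to one, and it is the profile of a similarity solution of the gap-size
evolution equation. Only the values of `φ` on `(0, ∞)` matter. -/
structure IsReducedGapDistribution (i : ℕ) (φ : ℝ → ℝ) : Prop where
  integrable : IntegrableOn φ (Ioi 0)
  mass : ∫ y in Ioi (0 : ℝ), φ y = 1
  integrable_mul : IntegrableOn (fun y => y * φ y) (Ioi 0)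
  mean : ∫ y in Ioi (0 : ℝ), y * φ y = 1
  similarity : ∃ (n : ℝ → ℝ → ℝ) (N : ℝ → ℝ) (V : ℝ), IsSimilaritySolution i φ n N V

/-- The one-dimensional capture-zone distribution `P(s) = 2 ∫_0^(2s) φ(y) φ(2s-y) dy`. -/
noncomputable def captureZone (φ : ℝ → ℝ) (s : ℝ) : ℝ :=
  2 * ∫ y in (0 : ℝ)..(2 * s), φ y * φ (2 * s - y)

/-- The Generalised Wigner Surmise `a_β s^β exp(-b_β s²)`, with the constants `a_β`, `b_β` that
give it total mass and mean one. -/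
noncomputable def wignerSurmise (β : ℝ) (s : ℝ) : ℝ :=
  2 * Real.Gamma ((β + 2) / 2) ^ (β + 1) / Real.Gamma ((β + 1) / 2) ^ (β + 2) * s ^ β
    * Real.exp (-(Real.Gamma ((β + 2) / 2) / Real.Gamma ((β + 1) / 2)) ^ 2 * s ^ 2)

/-! Put k = i + 1 and let J be the truncated moment of order k. Freezing x and differentiating
φ(N(t)x/V) = V n(x,t)/N(t)² in time turns the evolution equation into z φ' + 2 φ = κ (2 z^k J − B
z^(2k+1) φ), provided N' ≠ 0 at one instant. Near 0, J lies between two positive constants, so the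
integrating factor z² exp(b z^(2k+1)) gives a function F comparable to z² φ with F' comparable to κ
z^(k+1). Integrability of φ excludes φ ≥ d z⁻² near 0. This does three things: it rules out N' ≡ 0,
it rules out κ < 0, and it forces F to have no positive lower bound at 0. Hence F is of exact order
z^(k+2) and φ of exact order z^k (`exists_pow_bounds`). Self-convolution doubles the exponent and
adds one, giving 2k + 1 = 2i + 3. -/

/-! ### Chain rule for an outer function not known to be regular -/

/-- A function that is continuous near `a` and has positive derivative at `a` is open at `a`. -/
theorem nhds_le_map_of_deriv_pos {c : ℝ → ℝ} {c' a : ℝ} (hc : HasDerivAt c c' a) (h0 : 0 < c')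
    (hcont : ∀ᶠ t in 𝓝 a, ContinuousAt c t) : 𝓝 (c a) ≤ map c (𝓝 a) := by
  intro S hS
  obtain ⟨r, hr, hball⟩ := Metric.eventually_nhds_iff.1 (hcont.and hS)
  have hslope := (hasDerivAt_iff_tendsto_slope.1 hc).eventually (lt_mem_nhds h0)
  rw [eventually_nhdsWithin_iff] at hslope
  obtain ⟨q, hq, hs⟩ := Metric.eventually_nhds_iff.1 hslope
  set e := min r q / 2 with he
  have he0 : 0 < e := by positivity
  have her : e < r := by have := min_le_left r q; have := lt_min hr hq; linarith
  have heq : e < q := by have := min_le_right r q; have := lt_min hr hq; linarith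
  have hl : c (a - e) < c a := by
    have := hs (y := a - e) (by simp [abs_of_pos he0, heq])
      (by simp [he0.ne'])
    rw [slope_def_field] at this
    have h3 : a - e - a < 0 := by linarith
    have := (div_pos_iff.1 this).resolve_left fun h => by linarith [h.2]
    linarith [this.1]
  have hu : c a < c (a + e) := by
    have := hs (y := a + e) (by simp [abs_of_pos he0, heq])
      (by simp [he0.ne'])
    rw [slope_def_field] at this
    have h3 : 0 < a + e - a := by linarith
    have := (div_pos_iff_of_pos_right h3).1 this
    linarith
  have hsub : ∀ t ∈ Icc (a - e) (a + e), dist t a < r := by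
    intro t ht
    rw [Real.dist_eq, abs_lt]
    constructor <;> linarith [ht.1, ht.2]
  have hiv := intermediate_value_Icc (f := c) (a := a - e) (b := a + e) (by linarith)
    (fun t ht => (hball (hsub t ht)).1.continuousWithinAt)
  filter_upwards [Icc_mem_nhds hl hu] with z hz
  obtain ⟨t, ht, rfl⟩ := hiv hz
  exact (hball (hsub t ht)).2

theorem nhds_le_map_of_deriv_ne_zero {c : ℝ → ℝ} {c' a : ℝ} (hc : HasDerivAt c c' a)
    (h0 : c' ≠ 0) (hcont : ∀ᶠ t in 𝓝 a, ContinuousAt c t) : 𝓝 (c a) ≤ map c (𝓝 a) := by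
  rcases lt_or_gt_of_ne h0 with h | h
  · have h1 := nhds_le_map_of_deriv_pos hc.neg (neg_pos.2 h) (hcont.mono fun t ht => ht.neg)
    have h2 := map_mono (m := fun x : ℝ => -x) h1
    rw [map_map] at h2
    have h3 : map (fun x : ℝ => -x) (𝓝 ((-c) a)) = 𝓝 (c a) := by
      have := (Homeomorph.neg ℝ).map_nhds_eq ((-c) a)
      simpa using this
    rw [h3] at h2
    convert h2 using 2
    ext t; simp
  · exact nhds_le_map_of_deriv_pos hc h hcont

/-- The chain rule, solved for the derivative of the outer function. -/
theorem HasDerivAt.of_comp_right {h c : ℝ → ℝ} {c' g' a : ℝ} (hc : HasDerivAt c c' a)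
    (h0 : c' ≠ 0) (hcont : ∀ᶠ t in 𝓝 a, ContinuousAt c t)
    (hg : HasDerivAt (fun t => h (c t)) g' a) : HasDerivAt h (g' / c') (c a) := by
  rw [hasDerivAt_iff_isLittleO]
  -- Openness of `c` at `a` lets an estimate in `t` be read as one at every point near `c a`. No
  -- local inverse and no prior regularity of `h` is needed.
  refine IsLittleO.mono ?_ (nhds_le_map_of_deriv_ne_zero hc h0 hcont)
  rw [isLittleO_map]
  have h1 := hasDerivAt_iff_isLittleO.1 hg
  have h2 := (hasDerivAt_iff_isLittleO.1 hc).const_mul_left (g' / c')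
  have h3 : (fun t => t - a) =O[𝓝 a] fun t => c t - c a :=
    (hc.isTheta_sub h0).isBigO_symm.comp_tendsto (tendsto_id.prodMk tendsto_const_pure)
  refine ((h1.sub h2).trans_isBigO h3).congr_left fun t => ?_
  simp only [Function.comp, smul_eq_mul]
  field_simp
  ring

/-! ### Integrability at 0 and truncated moments -/

/-- A function that is integrable at the right of `0` is not bounded below by a positive multiple
of `z⁻²` there. -/
theorem not_inv_sq_le_of_integrableOn {φ : ℝ → ℝ} (hφ : IntegrableOn φ (Ioi 0)) {d r : ℝ}
    (hd : 0 < d) (hr : 0 < r) : ¬ ∀ z ∈ Ioo 0 r, d ≤ z ^ 2 * φ z := by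
  intro h
  have h1 : IntegrableOn (fun z : ℝ => d * z ^ (-2 : ℝ)) (Ioo 0 r) := by
    refine Integrable.mono' (hφ.mono_set Ioo_subset_Ioi_self) (by fun_prop) ?_
    refine (ae_restrict_iff' measurableSet_Ioo).2 (.of_forall fun z hz => ?_)
    have hz0 : 0 < z := hz.1
    have := h z hz
    rw [Real.norm_of_nonneg (by positivity), Real.rpow_neg hz0.le, Real.rpow_two,
      ← div_eq_mul_inv, div_le_iff₀ (by positivity)]
    linarith
  have h2 : IntegrableOn (fun z : ℝ => z ^ (-2 : ℝ)) (Ioo 0 r) := by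
    have := h1.const_mul d⁻¹
    refine this.congr (.of_forall fun z => ?_)
    field_simp
  rw [intervalIntegral.integrableOn_Ioo_rpow_iff hr] at h2
  norm_num at h2

/-- The truncated moment `∫_z^∞ (y - z)^k φ(y) dy`. -/
noncomputable def tailMoment (k : ℕ) (φ : ℝ → ℝ) (z : ℝ) : ℝ :=
  ∫ y in Ioi z, (y - z) ^ k * φ y

section TailMoment

variable {k : ℕ} {φ : ℝ → ℝ}

theorem tailMoment_antitoneOn (hpos : ∀ z, 0 < z → 0 ≤ φ z)
    (hint : ∀ z, 0 < z → IntegrableOn (fun y => (y - z) ^ k * φ y) (Ioi z)) :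
    AntitoneOn (tailMoment k φ) (Ioi 0) := by
  intro z hz w hw hzw
  have hz : 0 < z := hz
  unfold tailMoment
  calc ∫ y in Ioi w, (y - w) ^ k * φ y ≤ ∫ y in Ioi w, (y - z) ^ k * φ y := by
        refine setIntegral_mono_on (hint w hw) ((hint z hz).mono_set (Ioi_subset_Ioi hzw))
          measurableSet_Ioi fun y hy => ?_
        have hy : w < y := hy
        have := hpos y (by linarith)
        gcongr
    _ ≤ _ := by
        refine setIntegral_mono_set (hint z hz) ?_ (Ioi_subset_Ioi hzw).eventuallyLE
        refine (ae_restrict_iff' measurableSet_Ioi).2 (.of_forall fun y hy => ?_)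
        have hy : z < y := hy
        exact mul_nonneg (pow_nonneg (by linarith) _) (hpos y (by linarith))

/-- The majorant must not depend on z: for y ≤ 2 use (y − z)^k ≤ 2^k, and for y > 2 use y ≤ 2(y −
1), so that integrability of the moment at z = 1 controls all z > 0. -/
theorem exists_tailMoment_le (hpos : ∀ z, 0 < z → 0 ≤ φ z) (hφ : IntegrableOn φ (Ioi 0))
    (hint : ∀ z, 0 < z → IntegrableOn (fun y => (y - z) ^ k * φ y) (Ioi z)) :
    ∃ M, ∀ z, 0 < z → tailMoment k φ z ≤ M := by
  have hbound : IntegrableOn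
      (fun y => 2 ^ k * φ y + (Ioi 1).indicator (fun y => 2 ^ k * ((y - 1) ^ k * φ y)) y)
      (Ioi 0) := by
    exact (hφ.const_mul _).add
      ((integrable_indicator_iff measurableSet_Ioi).2 ((hint 1 one_pos).const_mul _)).integrableOn
  set b := fun y => 2 ^ k * φ y + (Ioi 1).indicator (fun y => 2 ^ k * ((y - 1) ^ k * φ y)) y
  have hb0 : ∀ y, 0 < y → 0 ≤ b y := by
    intro y hy
    have := hpos y hy
    refine add_nonneg (by positivity) (indicator_nonneg (fun y hy => ?_) y)
    have hy : (1 : ℝ) < y := hy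
    have := hpos y (by linarith)
    have : 0 ≤ y - 1 := by linarith
    positivity
  refine ⟨∫ y in Ioi 0, b y, fun z hz => ?_⟩
  calc tailMoment k φ z ≤ ∫ y in Ioi z, b y := by
        refine setIntegral_mono_on (hint z hz) (hbound.mono_set (Ioi_subset_Ioi hz.le))
          measurableSet_Ioi fun y hy => ?_
        have hy : z < y := hy
        have h0 := hpos y (by linarith)
        have h1 : (y - z) ^ k ≤ y ^ k := by (gcongr; linarith)
        rcases le_or_gt y 2 with h2 | h2
        · have h3 : y ^ k ≤ 2 ^ k := by gcongr; linarith
          have h4 : 0 ≤ (Ioi (1 : ℝ)).indicator (fun y => 2 ^ k * ((y - 1) ^ k * φ y)) y := by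
            refine indicator_nonneg (fun y hy => ?_) y
            have hy : (1 : ℝ) < y := hy
            have := hpos y (by linarith)
            have : 0 ≤ y - 1 := by linarith
            positivity
          have h5 := mul_le_mul_of_nonneg_right (h1.trans h3) h0
          simp only [b]
          linarith
        · have h3 : y ^ k ≤ 2 ^ k * (y - 1) ^ k := by
            rw [← mul_pow]; (gcongr; linarith)
          have h5 := mul_le_mul_of_nonneg_right (h1.trans h3) h0
          have h6 : 0 ≤ 2 ^ k * φ y := by positivity
          simp only [b]
          rw [indicator_of_mem (by simp; linarith)]
          linarith
    _ ≤ ∫ y in Ioi 0, b y := by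
        refine setIntegral_mono_set hbound ?_ (Ioi_subset_Ioi hz.le).eventuallyLE
        exact (ae_restrict_iff' measurableSet_Ioi).2 (.of_forall fun y hy => hb0 y hy)

/-- Otherwise φ would vanish almost everywhere beyond 1/2, and the mean would be at most half the
mass. -/
theorem tailMoment_half_pos (hpos : ∀ z, 0 < z → 0 ≤ φ z) (hφ : IntegrableOn φ (Ioi 0))
    (hmass : ∫ y in Ioi (0 : ℝ), φ y = 1) (hφ' : IntegrableOn (fun y => y * φ y) (Ioi 0))
    (hmean : ∫ y in Ioi (0 : ℝ), y * φ y = 1)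
    (hint : ∀ z, 0 < z → IntegrableOn (fun y => (y - z) ^ k * φ y) (Ioi z)) :
    0 < tailMoment k φ (1 / 2) := by
  have hnn : ∀ y ∈ Ioi (1 / 2 : ℝ), 0 ≤ (y - 1 / 2) ^ k * φ y := fun y hy => by
    have hy : 1 / 2 < y := hy
    exact mul_nonneg (pow_nonneg (by linarith) _) (hpos y (by linarith))
  refine lt_of_le_of_ne (setIntegral_nonneg measurableSet_Ioi hnn) fun h0 => ?_
  have h1 := (setIntegral_eq_zero_iff_of_nonneg_ae
    ((ae_restrict_iff' measurableSet_Ioi).2 (.of_forall hnn)) (hint _ (by norm_num))).1 h0.symm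
  rw [EventuallyEq, ae_restrict_iff' measurableSet_Ioi] at h1
  have h2 : ∫ y in Ioi (0 : ℝ), y * φ y ≤ ∫ y in Ioi (0 : ℝ), 1 / 2 * φ y := by
    refine setIntegral_mono_on_ae hφ' (hφ.const_mul _) measurableSet_Ioi ?_
    filter_upwards [h1] with y hy hy0
    have hy0 : 0 < y := hy0
    rcases le_or_gt y (1 / 2) with h | h
    · have := hpos y hy0
      gcongr
    · have h3 : 0 < (y - 1 / 2) ^ k := pow_pos (by linarith) _
      have : φ y = 0 := (mul_eq_zero.1 (hy h)).resolve_left h3.ne'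
      simp [this]
  rw [hmean, integral_const_mul, hmass] at h2
  norm_num at h2

end TailMoment

/-! ### Reduction to the similarity variable -/

/-- The evolution equation for a similarity solution, in the reduced variable `z = N(t) x / V`. -/
theorem IsSimilaritySolution.hasDerivAt_scaled {i : ℕ} {φ : ℝ → ℝ} {n : ℝ → ℝ → ℝ} {N : ℝ → ℝ}
    {V : ℝ} (h : IsSimilaritySolution i φ n N V) {z t : ℝ} (hz : 0 < z) (ht : 0 < t) :
    HasDerivAt (fun τ => n (V / N t * z) τ)
      (N t ^ 2 / V * (V / N t) ^ (2 * i + 3) *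
        (2 * z ^ (i + 1) * tailMoment (i + 1) φ z -
          ProbabilityTheory.beta ((i : ℝ) + 2) ((i : ℝ) + 2) * z ^ (2 * i + 3) * φ z)) t := by
  have hN := h.N_pos t ht
  have hV := h.V_pos
  have hx : 0 < V / N t * z := by positivity
  have hφz : n (V / N t * z) t = N t ^ 2 / V * φ z := by
    rw [h.similarity _ _ hx ht]
    congr 2
    field_simp
  have hint : ∫ y in Ioi (V / N t * z), (V / N t * z) ^ (i + 1) * (y - V / N t * z) ^ (i + 1) * n y t
      = N t ^ 2 / V * (V / N t) ^ (2 * i + 3) * (z ^ (i + 1) * tailMoment (i + 1) φ z) := by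
    have h1 := integral_comp_mul_left_Ioi (fun y => (y - z) ^ (i + 1) * φ y) (V / N t * z)
      (show 0 < N t / V by positivity)
    have h2 : N t / V * (V / N t * z) = z := by field_simp
    rw [h2, smul_eq_mul] at h1
    rw [tailMoment, show (∫ y in Ioi z, (y - z) ^ (i + 1) * φ y) = N t / V *
      ∫ y in Ioi (V / N t * z), (N t / V * y - z) ^ (i + 1) * φ (N t / V * y) by
        rw [h1]; field_simp, ← integral_const_mul, ← integral_const_mul, ← integral_const_mul]
    refine setIntegral_congr_fun measurableSet_Ioi fun y hy => ?_
    have hy : V / N t * z < y := hy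
    have h3 : N t / V * y - z = N t / V * (y - V / N t * z) := by field_simp
    have h4 : V / N t ≠ 0 := by positivity
    rw [h.similarity y t (hx.trans hy) ht, h3, show N t * y / V = N t / V * y by ring,
      ← inv_div V (N t)]
    generalize V / N t = c at h4 ⊢
    generalize N t ^ 2 / V = q
    generalize φ (c⁻¹ * y) = p
    rw [mul_pow, mul_pow, inv_pow]
    field_simp
    ring
  convert h.solution.evolution _ t hx ht using 1
  rw [hint, hφz, mul_pow]
  ring

theorem IsSimilaritySolution.nonneg {i : ℕ} {φ : ℝ → ℝ} {n : ℝ → ℝ → ℝ} {N : ℝ → ℝ}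
    {V : ℝ} (h : IsSimilaritySolution i φ n N V) {z : ℝ} (hz : 0 < z) : 0 ≤ φ z := by
  have hN := h.N_pos 1 one_pos
  have hV := h.V_pos
  have hx : 0 < V / N 1 * z := by positivity
  have h1 := h.solution.nonneg _ 1 hx one_pos
  rw [h.similarity _ _ hx one_pos, show N 1 * (V / N 1 * z) / V = z by field_simp] at h1
  exact nonneg_of_mul_nonneg_right h1 (by positivity)

theorem IsSimilaritySolution.integrableOn_tail {i : ℕ} {φ : ℝ → ℝ} {n : ℝ → ℝ → ℝ} {N : ℝ → ℝ}
    {V : ℝ} (h : IsSimilaritySolution i φ n N V) {z : ℝ} (hz : 0 < z) :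
    IntegrableOn (fun y => (y - z) ^ (i + 1) * φ y) (Ioi z) := by
  have hN := h.N_pos 1 one_pos
  have hV := h.V_pos
  have hx : 0 < V / N 1 * z := by positivity
  have hc : 0 < N 1 / V := by positivity
  have h2 : N 1 / V * (V / N 1 * z) = z := by field_simp
  rw [← h2, ← integrableOn_Ioi_comp_mul_left_iff _ _ hc, h2]
  have h1 := (h.solution.integrable _ 1 hx one_pos).const_mul
    (((V / N 1 * z) ^ (i + 1))⁻¹ * (N 1 / V) ^ (i + 1) * (N 1 ^ 2 / V)⁻¹)
  refine IntegrableOn.congr_fun h1 (fun y hy => ?_) measurableSet_Ioi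
  have hy : V / N 1 * z < y := hy
  have h3 : N 1 / V * y - z = N 1 / V * (y - V / N 1 * z) := by field_simp
  rw [h.similarity y 1 (hx.trans hy) one_pos, h3, show N 1 * y / V = N 1 / V * y by ring,
    mul_pow (N 1 / V)]
  have h4 : (V / N 1 * z) ^ (i + 1) ≠ 0 := by positivity
  have h5 : N 1 ^ 2 / V ≠ 0 := by positivity
  generalize (V / N 1 * z) ^ (i + 1) = p at *
  generalize N 1 ^ 2 / V = q at *
  field_simp

/-- If the number of gaps is not stationary, the reduced gap-size distribution is differentiable
and solves an integro-differential equation. -/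
theorem IsSimilaritySolution.exists_hasDerivAt {i : ℕ} {φ : ℝ → ℝ} {n : ℝ → ℝ → ℝ} {N : ℝ → ℝ}
    {V : ℝ} (h : IsSimilaritySolution i φ n N V) {t : ℝ} (ht : 0 < t) (hN' : deriv N t ≠ 0) :
    ∃ κ : ℝ, κ ≠ 0 ∧ ∀ z, 0 < z → HasDerivAt φ
      ((κ * (2 * z ^ (i + 1) * tailMoment (i + 1) φ z -
        ProbabilityTheory.beta ((i : ℝ) + 2) ((i : ℝ) + 2) * z ^ (2 * i + 3) * φ z)
          - 2 * φ z) / z) z := by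
  have hN := h.N_pos t ht
  have hV := h.V_pos
  -- With x frozen at V z / N(t), moving time sweeps the reduced variable through z. The sign of κ
  -- is that of N'(t), still unknown here.
  refine ⟨N t / deriv N t * (V / N t) ^ (2 * i + 3), by positivity, fun z hz => ?_⟩
  have hd := (h.N_differentiable t ht).hasDerivAt
  have hx : 0 < V / N t * z := by positivity
  have hC := (hd.mul_const (V / N t * z)).div_const V
  have hCt : N t * (V / N t * z) / V = z := by field_simp
  have hg := ((h.hasDerivAt_scaled hz ht).mul_const V).div (hd.pow 2) (by simp; positivity)
  -- The right side is differentiable in time although φ is not yet known to be; the denominator N²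
  -- produces the term −2φ.
  have heq : (fun τ => φ (N τ * (V / N t * z) / V)) =ᶠ[𝓝 t]
      (fun τ => n (V / N t * z) τ * V) / N ^ 2 := by
    filter_upwards [lt_mem_nhds ht] with τ hτ
    have := h.N_pos τ hτ
    simp only [Pi.div_apply, Pi.pow_apply]
    rw [h.similarity _ τ hx hτ]
    field_simp
  have hcont : ∀ᶠ τ in 𝓝 t, ContinuousAt (fun τ => N τ * (V / N t * z) / V) τ := by
    filter_upwards [lt_mem_nhds ht] with τ hτ
    exact ((h.N_differentiable τ hτ).continuousAt.mul_const _).div_const _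
  have hres := HasDerivAt.of_comp_right hC (by positivity) hcont (hg.congr_of_eventuallyEq heq)
  simp only [hCt] at hres
  convert hres using 1
  have hφz : n (V / N t * z) t = N t ^ 2 / V * φ z := by
    rw [h.similarity _ _ hx ht, hCt]
  rw [hφz]
  generalize (V / N t) ^ (2 * i + 3) = p
  simp only [Pi.pow_apply]
  field_simp
  ring

/-- Constant N makes n independent of time, so gain and loss balance; this is the case to be
excluded later. -/
theorem IsSimilaritySolution.stationary_eq {i : ℕ} {φ : ℝ → ℝ} {n : ℝ → ℝ → ℝ} {N : ℝ → ℝ}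
    {V : ℝ} (h : IsSimilaritySolution i φ n N V) (hN' : ∀ t, 0 < t → deriv N t = 0)
    {z : ℝ} (hz : 0 < z) :
    2 * z ^ (i + 1) * tailMoment (i + 1) φ z =
      ProbabilityTheory.beta ((i : ℝ) + 2) ((i : ℝ) + 2) * z ^ (2 * i + 3) * φ z := by
  have hN := h.N_pos 1 one_pos
  have hV := h.V_pos
  have hconst : ∀ t, 0 < t → N t = N 1 := fun t ht =>
    isOpen_Ioi.is_const_of_deriv_eq_zero isPreconnected_Ioi
      (fun τ hτ => (h.N_differentiable τ hτ).differentiableWithinAt) (fun τ hτ => hN' τ hτ)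
      (show t ∈ Ioi 0 from ht) (show (1 : ℝ) ∈ Ioi 0 from zero_lt_one (α := ℝ))
  have hx : 0 < V / N 1 * z := by positivity
  have h1 : HasDerivAt (fun τ => n (V / N 1 * z) τ) 0 1 := by
    refine (hasDerivAt_const (1 : ℝ) (n (V / N 1 * z) 1)).congr_of_eventuallyEq ?_
    filter_upwards [lt_mem_nhds one_pos] with τ hτ
    rw [h.similarity _ τ hx hτ, h.similarity _ 1 hx one_pos, hconst τ hτ]
  have h2 := (h.hasDerivAt_scaled hz one_pos).unique h1
  have h3 : N 1 ^ 2 / V * (V / N 1) ^ (2 * i + 3) ≠ 0 := by positivity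
  linarith [(mul_eq_zero.1 h2).resolve_left h3]

/-! ### Exact order of φ at 0 -/

/-- The behaviour at `0` of nonnegative integrable solutions of
`z φ' + 2 φ = κ (2 z^k J - B z^(2k+1) φ)`. -/
theorem exists_pow_bounds {k : ℕ} {φ J : ℝ → ℝ} {B κ j M : ℝ} (hpos : ∀ z, 0 < z → 0 ≤ φ z)
    (hφ : IntegrableOn φ (Ioi 0)) (hκ : κ ≠ 0) (hj : 0 < j)
    (hJ : ∀ z ∈ Ioo (0 : ℝ) (1 / 2), j ≤ J z ∧ J z ≤ M)
    (hode : ∀ z, 0 < z → HasDerivAt φ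
      ((κ * (2 * z ^ k * J z - B * z ^ (2 * k + 1) * φ z) - 2 * φ z) / z) z) :
    ∃ a₁ a₂ : ℝ, 0 < a₁ ∧ ∀ z ∈ Ioo (0 : ℝ) (1 / 2), a₁ * z ^ k ≤ φ z ∧ φ z ≤ a₂ * z ^ k := by
  -- In F the factor z² absorbs the term 2φ, and E absorbs the loss term, leaving only the gain term
  -- in F'.
  set b := κ * B / (2 * k + 1) with hb
  set E : ℝ → ℝ := fun z => Real.exp (b * z ^ (2 * k + 1)) with hE
  set F : ℝ → ℝ := fun z => z ^ 2 * φ z * E z with hF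
  have hE0 : ∀ z, 0 < E z := fun z => Real.exp_pos _
  have hF0 : ∀ z, 0 < z → 0 ≤ F z := fun z hz =>
    mul_nonneg (mul_nonneg (sq_nonneg z) (hpos z hz)) (hE0 z).le
  have hEb : ∀ z ∈ Ioo (0 : ℝ) (1 / 2), Real.exp (-|b|) ≤ E z ∧ E z ≤ Real.exp |b| := by
    intro z hz
    have h1 : |b * z ^ (2 * k + 1)| ≤ |b| := by
      rw [abs_mul, abs_of_nonneg (pow_nonneg hz.1.le _)]
      exact mul_le_of_le_one_right (abs_nonneg b)
        (pow_le_one₀ hz.1.le (by linarith [hz.2]))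
    exact ⟨Real.exp_le_exp.2 (abs_le.1 h1).1, Real.exp_le_exp.2 (abs_le.1 h1).2⟩
  have hFd : ∀ z, 0 < z → HasDerivAt F (2 * κ * z ^ (k + 1) * J z * E z) z := by
    intro z hz
    have h1 := (((hasDerivAt_pow 2 z).mul (hode z hz)).mul
      ((hasDerivAt_pow (2 * k + 1) z).const_mul b).exp)
    refine h1.congr_deriv ?_
    simp only [hE, hb]
    push_cast
    have : (2 * (k : ℝ) + 1) ≠ 0 := by positivity
    simp only [Pi.mul_apply]
    field_simp
    ring
  have hFcont : ContinuousOn F (Ioo 0 (1 / 2)) := fun z hz =>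
    (hFd z hz.1).continuousAt.continuousWithinAt
  have hno : ∀ d r : ℝ, 0 < d → 0 < r → r ≤ 1 / 2 → ¬ ∀ z ∈ Ioo 0 r, d ≤ F z := by
    intro d r hd hr hr' hdF
    refine not_inv_sq_le_of_integrableOn hφ (d := d / Real.exp |b|) (by positivity) hr
      fun z hz => ?_
    have h1 := hdF z hz
    have h2 := (hEb z ⟨hz.1, hz.2.trans_le hr'⟩).2
    rw [div_le_iff₀ (by positivity)]
    have := mul_le_mul_of_nonneg_left h2 (mul_nonneg (sq_nonneg z) (hpos z hz.1))
    linarith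
  rcases lt_or_gt_of_ne hκ with hneg | hκ
  -- For κ < 0, F increases towards 0 and so stays above F(1/4) > 0 on (0, 1/4), against `hno`.
  · have hanti : StrictAntiOn F (Ioo 0 (1 / 2)) := by
      refine strictAntiOn_of_deriv_neg (convex_Ioo _ _) hFcont fun z hz => ?_
      rw [interior_Ioo] at hz
      rw [(hFd z hz.1).deriv]
      have h1 := hj.trans_le (hJ z hz).1
      have h2 := pow_pos hz.1 (k + 1)
      have : 0 < z ^ (k + 1) * J z * E z := mul_pos (mul_pos h2 h1) (hE0 z)
      nlinarith
    have h1 := hanti (a := 1 / 4) (b := 3 / 8) (by norm_num) (by norm_num) (by norm_num)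
    have h2 := hF0 (3 / 8) (by norm_num)
    exact (hno (F (1 / 4)) (1 / 4) (by linarith) (by norm_num) (by norm_num) fun z hz =>
      (hanti ⟨hz.1, by linarith [hz.2]⟩ (by norm_num) hz.2).le).elim
  have hsub : ∀ A z : ℝ, 0 < z → HasDerivAt (fun z => F z - A / (k + 2) * z ^ (k + 2))
      (2 * κ * z ^ (k + 1) * J z * E z - A * z ^ (k + 1)) z := by
    intro A z hz
    refine ((hFd z hz).sub ((hasDerivAt_pow (k + 2) z).const_mul (A / (k + 2)))).congr_deriv ?_
    push_cast
    field_simp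
  have hsubc : ∀ A : ℝ, ContinuousOn (fun z => F z - A / (k + 2) * z ^ (k + 2))
      (Ioo 0 (1 / 2)) := fun A z hz => (hsub A z hz.1).continuousAt.continuousWithinAt
  -- These bound F' / z^(k+1) from below and above.
  set A₁ := 2 * κ * j * Real.exp (-|b|) with hA₁
  set A₂ := 2 * κ * M * Real.exp |b| with hA₂
  have hmono : MonotoneOn (fun z => F z - A₁ / (k + 2) * z ^ (k + 2)) (Ioo 0 (1 / 2)) := by
    refine monotoneOn_of_deriv_nonneg (convex_Ioo _ _) (hsubc _)
      (fun z hz => ?_) fun z hz => ?_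
    · rw [interior_Ioo] at hz
      exact (hsub _ z hz.1).differentiableAt.differentiableWithinAt
    · rw [interior_Ioo] at hz
      rw [(hsub _ z hz.1).deriv]
      have h1 : j * Real.exp (-|b|) ≤ J z * E z :=
        mul_le_mul (hJ z hz).1 (hEb z hz).1 (Real.exp_pos _).le (hj.le.trans (hJ z hz).1)
      have h2 := mul_le_mul_of_nonneg_left h1
        (mul_nonneg (mul_nonneg zero_le_two hκ.le) (pow_nonneg hz.1.le (k + 1)))
      simp only [hA₁]
      linarith
  have hanti : AntitoneOn (fun z => F z - A₂ / (k + 2) * z ^ (k + 2)) (Ioo 0 (1 / 2)) := by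
    refine antitoneOn_of_deriv_nonpos (convex_Ioo _ _) (hsubc _)
      (fun z hz => ?_) fun z hz => ?_
    · rw [interior_Ioo] at hz
      exact (hsub _ z hz.1).differentiableAt.differentiableWithinAt
    · rw [interior_Ioo] at hz
      rw [(hsub _ z hz.1).deriv]
      have h1 : J z * E z ≤ M * Real.exp |b| :=
        mul_le_mul (hJ z hz).2 (hEb z hz).2 (hE0 z).le (hj.le.trans ((hJ z hz).1.trans (hJ z hz).2))
      have h2 := mul_le_mul_of_nonneg_left h1
        (mul_nonneg (mul_nonneg zero_le_two hκ.le) (pow_nonneg hz.1.le (k + 1)))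
      simp only [hA₂]
      linarith
  have hlow : ∀ z ∈ Ioo (0 : ℝ) (1 / 2), A₁ / (k + 2) * z ^ (k + 2) ≤ F z := by
    intro z hz
    have hlim : Tendsto (fun e : ℝ => -(A₁ / (k + 2) * e ^ (k + 2))) (𝓝[>] 0) (𝓝 0) := by
      have : Continuous fun e : ℝ => -(A₁ / (k + 2) * e ^ (k + 2)) := by fun_prop
      have h0 := (this.tendsto 0).mono_left (nhdsWithin_le_nhds (s := Ioi 0))
      simpa using h0
    have := le_of_tendsto hlim (b := F z - A₁ / (k + 2) * z ^ (k + 2)) (by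
      filter_upwards [Ioo_mem_nhdsGT hz.1] with e he
      have h1 := hmono ⟨he.1, he.2.trans hz.2⟩ hz he.2.le
      have h2 := hF0 e he.1
      simp only at h1
      linarith)
    linarith
  have hup : ∀ z ∈ Ioo (0 : ℝ) (1 / 2), F z ≤ A₂ / (k + 2) * z ^ (k + 2) := by
    intro z hz
    -- By monotonicity an excess at z persists on all of (0, z), giving F a positive lower bound
    -- there.
    by_contra! hlt
    refine hno (F z - A₂ / (k + 2) * z ^ (k + 2)) z (by linarith) hz.1 hz.2.le fun w hw => ?_
    have h1 := hanti ⟨hw.1, hw.2.trans hz.2⟩ hz hw.2.le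
    simp only at h1
    have hM : 0 ≤ M := hj.le.trans ((hJ z hz).1.trans (hJ z hz).2)
    have h2 : 0 ≤ A₂ / (k + 2) * w ^ (k + 2) :=
      mul_nonneg (by positivity) (pow_nonneg hw.1.le _)
    linarith
  refine ⟨A₁ / (k + 2) / Real.exp |b|, A₂ / (k + 2) / Real.exp (-|b|), by positivity,
    fun z hz => ?_⟩
  have hz0 := hz.1
  have hnn := mul_nonneg (sq_nonneg z) (hpos z hz.1)
  have h1 := (hlow z hz).trans (mul_le_mul_of_nonneg_left (hEb z hz).2 hnn)
  have h2 := (mul_le_mul_of_nonneg_left (hEb z hz).1 hnn).trans (hup z hz)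
  constructor
  · rw [div_mul_eq_mul_div, div_le_iff₀ (by positivity)]
    refine le_of_mul_le_mul_left ?_ (show 0 < z ^ 2 by positivity)
    rw [pow_add] at h1
    linarith
  · rw [div_mul_eq_mul_div, le_div_iff₀ (by positivity)]
    refine le_of_mul_le_mul_left ?_ (show 0 < z ^ 2 by positivity)
    rw [pow_add] at h2
    linarith

/-! ### Self-convolution of φ -/

/-- A function continuous on `(0, ∞)` and `O(z^k)` at `0` has an integrable self-convolution
integrand. -/
theorem intervalIntegrable_captureZone {k : ℕ} {φ : ℝ → ℝ} {r a : ℝ} (hr : 0 < r)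
    (hc : ContinuousOn φ (Ioi 0)) (hpos : ∀ z, 0 < z → 0 ≤ φ z)
    (hle : ∀ z ∈ Ioo 0 r, φ z ≤ a * z ^ k) {s : ℝ} (hs : 0 < s) :
    IntervalIntegrable (fun y => φ y * φ (2 * s - y)) volume 0 (2 * s) := by
  have hbdd : ∃ K, ∀ z ∈ Ioo 0 (2 * s), φ z ≤ K := by
    obtain ⟨K, hK⟩ := isCompact_Icc.bddAbove_image
      (hc.mono (show Icc (r / 2) (2 * s) ⊆ Ioi 0 from fun z hz =>
        (half_pos hr).trans_le hz.1))
    refine ⟨max K (|a| * r ^ k), fun z hz => ?_⟩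
    rcases le_or_gt (r / 2) z with h | h
    · exact le_max_of_le_left (hK ⟨z, ⟨h, hz.2.le⟩, rfl⟩)
    · have hzr : z < r := by linarith
      refine le_max_of_le_right ((hle z ⟨hz.1, hzr⟩).trans ?_)
      exact mul_le_mul (le_abs_self a) (pow_le_pow_left₀ hz.1.le hzr.le _)
        (pow_nonneg hz.1.le _) (abs_nonneg a)
  obtain ⟨K, hK⟩ := hbdd
  have hrefl : ∀ y ∈ Ioo 0 (2 * s), 2 * s - y ∈ Ioo 0 (2 * s) := fun y hy =>
    ⟨by linarith [hy.2], by linarith [hy.1]⟩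
  rw [intervalIntegrable_iff_integrableOn_Ioo_of_le (by linarith)]
  have hcont : ContinuousOn (fun y => φ y * φ (2 * s - y)) (Ioo 0 (2 * s)) :=
    (hc.mono Ioo_subset_Ioi_self).mul
      (hc.comp (by fun_prop) fun y hy => (hrefl y hy).1)
  refine Integrable.of_bound (hcont.aestronglyMeasurable measurableSet_Ioo) (K * K) ?_
  refine (ae_restrict_iff' measurableSet_Ioo).2 (.of_forall fun y hy => ?_)
  have h1 := hpos y hy.1
  have h2 := hpos _ (hrefl y hy).1
  rw [Real.norm_of_nonneg (mul_nonneg h1 h2)]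
  exact mul_le_mul (hK y hy) (hK _ (hrefl y hy)) h2 (h1.trans (hK y hy))

theorem integral_pow_mul_sub_pow (k : ℕ) (L : ℝ) :
    ∫ y in (0 : ℝ)..L, y ^ k * (L - y) ^ k =
      L ^ (2 * k + 1) * ∫ u in (0 : ℝ)..1, u ^ k * (1 - u) ^ k := by
  have h := intervalIntegral.smul_integral_comp_mul_left (a := 0) (b := 1)
    (fun y : ℝ => y ^ k * (L - y) ^ k) L
  simp only [mul_zero, mul_one, smul_eq_mul] at h
  rw [← h, ← intervalIntegral.integral_const_mul, ← intervalIntegral.integral_const_mul]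
  refine intervalIntegral.integral_congr fun u _ => ?_
  rw [show L - L * u = L * (1 - u) by ring, mul_pow, mul_pow]
  ring

theorem integral_pow_mul_one_sub_pow_pos (k : ℕ) :
    0 < ∫ u in (0 : ℝ)..1, u ^ k * (1 - u) ^ k := by
  refine intervalIntegral.intervalIntegral_pos_of_pos_on
    (Continuous.intervalIntegrable (by fun_prop) _ _) (fun u hu => ?_) one_pos
  have := hu.1
  have : 0 < 1 - u := by linarith [hu.2]
  positivity

/-- Since 2s < r, both arguments stay where φ is comparable to a k-th power; scaling then gives k +
k from the factors and 1 from dy. -/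
theorem captureZone_bounds {k : ℕ} {φ : ℝ → ℝ} {r a₁ a₂ : ℝ} (hr : 0 < r)
    (hc : ContinuousOn φ (Ioi 0)) (hpos : ∀ z, 0 < z → 0 ≤ φ z) (ha : 0 < a₁)
    (hφ : ∀ z ∈ Ioo 0 r, a₁ * z ^ k ≤ φ z ∧ φ z ≤ a₂ * z ^ k) :
    ∃ c₁ c₂ : ℝ, 0 < c₁ ∧ ∀ s ∈ Ioo 0 (r / 2),
      c₁ * s ^ (2 * k + 1) ≤ captureZone φ s ∧ captureZone φ s ≤ c₂ * s ^ (2 * k + 1) := by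
  set I := ∫ u in (0 : ℝ)..1, u ^ k * (1 - u) ^ k
  have hI : 0 < I := integral_pow_mul_one_sub_pow_pos k
  refine ⟨2 * (a₁ ^ 2 * (2 ^ (2 * k + 1) * I)), 2 * (a₂ ^ 2 * (2 ^ (2 * k + 1) * I)),
    by positivity, fun s hs => ?_⟩
  have hs0 := hs.1
  have hint := intervalIntegrable_captureZone hr hc hpos (fun z hz => (hφ z hz).2) hs0
  have hval : ∀ a : ℝ, ∫ y in (0 : ℝ)..2 * s, a ^ 2 * (y ^ k * (2 * s - y) ^ k) =
      a ^ 2 * (2 ^ (2 * k + 1) * I) * s ^ (2 * k + 1) := fun a => by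
    rw [intervalIntegral.integral_const_mul, integral_pow_mul_sub_pow, mul_pow]
    ring
  have hpoly : ∀ a : ℝ, IntervalIntegrable (fun y => a ^ 2 * (y ^ k * (2 * s - y) ^ k)) volume
      0 (2 * s) := fun a => Continuous.intervalIntegrable (by fun_prop) _ _
  have hy : ∀ y ∈ Ioo 0 (2 * s), y ∈ Ioo 0 r ∧ 2 * s - y ∈ Ioo 0 r := fun y hy =>
    ⟨⟨hy.1, by linarith [hy.2, hs.2]⟩, ⟨by linarith [hy.2], by linarith [hy.1, hs.2]⟩⟩
  have h1 := intervalIntegral.integral_mono_on_of_le_Ioo (by linarith) (hpoly a₁) hint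
    fun y h => by
      obtain ⟨h1, h2⟩ := hy y h
      have := mul_le_mul (hφ y h1).1 (hφ _ h2).1
        (mul_nonneg ha.le (pow_nonneg h2.1.le _)) (hpos y h1.1)
      linarith
  have h2 := intervalIntegral.integral_mono_on_of_le_Ioo (by linarith) hint (hpoly a₂)
    fun y h => by
      obtain ⟨h1, h2⟩ := hy y h
      have := mul_le_mul (hφ y h1).2 (hφ _ h2).2
        (hpos _ h2.1) ((hpos y h1.1).trans (hφ y h1).2)
      linarith
  rw [hval] at h1 h2
  unfold captureZone
  constructor <;> linarith

/-! ### Comparison with the surmise and conclusion -/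

theorem pow_isLittleO_wignerSurmise (i : ℕ) :
    (fun s : ℝ => s ^ (2 * i + 3)) =o[𝓝[>] (0 : ℝ)] wignerSurmise (2 * ((i : ℝ) + 1)) := by
  set β : ℝ := 2 * ((i : ℝ) + 1) with hβ
  have hβ0 : 0 < β := by positivity
  have hG1 := Real.Gamma_pos_of_pos (s := (β + 2) / 2) (by positivity)
  have hG2 := Real.Gamma_pos_of_pos (s := (β + 1) / 2) (by positivity)
  set a := 2 * Real.Gamma ((β + 2) / 2) ^ (β + 1) / Real.Gamma ((β + 1) / 2) ^ (β + 2) with ha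
  have ha0 : 0 < a := by positivity
  set b := (Real.Gamma ((β + 2) / 2) / Real.Gamma ((β + 1) / 2)) ^ 2 with hb
  have hO : (fun s : ℝ => s ^ (2 * i + 2)) =O[𝓝[>] (0 : ℝ)] wignerSurmise β := by
    refine IsBigO.of_bound (a * Real.exp (-b))⁻¹ ?_
    filter_upwards [Ioo_mem_nhdsGT one_pos] with s hs
    have hs0 := hs.1
    have hpow : s ^ β = s ^ (2 * i + 2) := by
      rw [← Real.rpow_natCast, hβ]
      congr 1
      push_cast
      ring
    have hexp : Real.exp (-b) ≤ Real.exp (-b * s ^ 2) := by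
      refine Real.exp_le_exp.2 ?_
      have hb0 : 0 ≤ b := sq_nonneg _
      have : s ^ 2 ≤ 1 := pow_le_one₀ hs0.le hs.2.le
      nlinarith
    have hW : wignerSurmise β s = a * s ^ (2 * i + 2) * Real.exp (-b * s ^ 2) := by
      rw [wignerSurmise, hpow]
    rw [hW, Real.norm_of_nonneg (by positivity), Real.norm_of_nonneg (by positivity),
      inv_mul_eq_div, le_div_iff₀ (by positivity)]
    have := mul_le_mul_of_nonneg_left hexp (show 0 ≤ a * s ^ (2 * i + 2) by positivity)
    linarith
  have ho : (fun s : ℝ => s) =o[𝓝[>] (0 : ℝ)] fun _ => (1 : ℝ) :=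
    (isLittleO_one_iff ℝ).2 (tendsto_id.mono_left nhdsWithin_le_nhds)
  refine (ho.mul_isBigO hO).congr (fun s => ?_) fun s => one_mul _
  ring

theorem IsReducedGapDistribution.exists_bounds {i : ℕ} {φ : ℝ → ℝ}
    (hφ : IsReducedGapDistribution i φ) :
    ContinuousOn φ (Ioi 0) ∧ (∀ z, 0 < z → 0 ≤ φ z) ∧ ∃ a₁ a₂ : ℝ, 0 < a₁ ∧
      ∀ z ∈ Ioo (0 : ℝ) (1 / 2), a₁ * z ^ (i + 1) ≤ φ z ∧ φ z ≤ a₂ * z ^ (i + 1) := by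
  obtain ⟨n, N, V, h⟩ := hφ.similarity
  have hpos : ∀ z, 0 < z → 0 ≤ φ z := fun z hz => h.nonneg hz
  have hint : ∀ z, 0 < z → IntegrableOn (fun y => (y - z) ^ (i + 1) * φ y) (Ioi z) :=
    fun z hz => h.integrableOn_tail hz
  have hj := tailMoment_half_pos hpos hφ.integrable hφ.mass hφ.integrable_mul hφ.mean hint
  have hjle : ∀ z ∈ Ioo (0 : ℝ) (1 / 2),
      tailMoment (i + 1) φ (1 / 2) ≤ tailMoment (i + 1) φ z := fun z hz =>
    tailMoment_antitoneOn hpos hint hz.1 (show (1 / 2 : ℝ) ∈ Ioi 0 by norm_num) hz.2.le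
  obtain ⟨M, hM⟩ := exists_tailMoment_le hpos hφ.integrable hint
  -- If N' ≡ 0, the balance of gain and loss gives φ = 2J / (B z^(i+2)), at least a multiple of z⁻²
  -- near 0, which is not integrable.
  have hN : ∃ t, 0 < t ∧ deriv N t ≠ 0 := by
    by_contra! hN
    have hB : 0 < ProbabilityTheory.beta ((i : ℝ) + 2) ((i : ℝ) + 2) :=
      ProbabilityTheory.beta_pos (by positivity) (by positivity)
    set B := ProbabilityTheory.beta ((i : ℝ) + 2) ((i : ℝ) + 2)
    refine not_inv_sq_le_of_integrableOn hφ.integrable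
      (d := 2 * tailMoment (i + 1) φ (1 / 2) / B) (r := 1 / 2) (by positivity) (by norm_num)
      fun z hz => ?_
    have hz0 := hz.1
    have h1 := h.stationary_eq hN hz0
    have h2 : 2 * tailMoment (i + 1) φ z = B * z ^ (i + 2) * φ z := by
      refine mul_left_cancel₀ (show z ^ (i + 1) ≠ 0 by positivity) ?_
      have : z ^ (2 * i + 3) = z ^ (i + 1) * z ^ (i + 2) := by rw [← pow_add]; congr 1; ring
      rw [this] at h1
      linarith
    have h3 : z ^ (i + 2) ≤ z ^ 2 :=
      pow_le_pow_of_le_one hz0.le (by linarith [hz.2]) (by linarith)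
    have h4 := mul_le_mul_of_nonneg_left h3 (mul_nonneg hB.le (hpos z hz0))
    rw [div_le_iff₀ hB]
    linarith [hjle z hz]
  obtain ⟨t, ht, hN'⟩ := hN
  obtain ⟨κ, hκ, hode⟩ := h.exists_hasDerivAt ht hN'
  exact ⟨fun z hz => (hode z hz).continuousAt.continuousWithinAt, hpos,
    exists_pow_bounds hpos hφ.integrable hκ hj (fun z hz => ⟨hjle z hz, hM z hz.1⟩) hode⟩

theorem theorem2 (i : ℕ) (φ : ℝ → ℝ) (hφ : IsReducedGapDistribution i φ) :
    (∀ s : ℝ, 0 < s →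
      IntervalIntegrable (fun y => φ y * φ (2 * s - y)) volume 0 (2 * s)) ∧
    captureZone φ =O[𝓝[>] (0 : ℝ)] (fun s : ℝ => s ^ (2 * i + 3)) ∧
    (fun s : ℝ => s ^ (2 * i + 3)) =O[𝓝[>] (0 : ℝ)] captureZone φ ∧
    captureZone φ =o[𝓝[>] (0 : ℝ)] wignerSurmise (2 * ((i : ℝ) + 1)) := by
  obtain ⟨hc, hpos, a₁, a₂, ha, hb⟩ := hφ.exists_bounds
  obtain ⟨c₁, c₂, hc₁, hP⟩ := captureZone_bounds (by norm_num) hc hpos ha hb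
  rw [show 2 * (i + 1) + 1 = 2 * i + 3 by ring] at hP
  have hO : captureZone φ =O[𝓝[>] (0 : ℝ)] (fun s : ℝ => s ^ (2 * i + 3)) := by
    refine IsBigO.of_bound c₂ ?_
    filter_upwards [Ioo_mem_nhdsGT (show (0 : ℝ) < 1 / 2 / 2 by norm_num)] with s hs
    have hs0 : 0 < s ^ (2 * i + 3) := pow_pos hs.1 _
    obtain ⟨h1, h2⟩ := hP s hs
    rwa [Real.norm_of_nonneg ((by positivity : 0 ≤ c₁ * s ^ (2 * i + 3)).trans h1),
      Real.norm_of_nonneg hs0.le]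
  refine ⟨fun s hs => intervalIntegrable_captureZone (by norm_num) hc hpos
    (fun z hz => (hb z hz).2) hs, hO, ?_, hO.trans_isLittleO (pow_isLittleO_wignerSurmise i)⟩
  refine IsBigO.of_bound c₁⁻¹ ?_
  filter_upwards [Ioo_mem_nhdsGT (show (0 : ℝ) < 1 / 2 / 2 by norm_num)] with s hs
  have hs0 : 0 < s ^ (2 * i + 3) := pow_pos hs.1 _
  obtain ⟨h1, h2⟩ := hP s hs
  rw [Real.norm_of_nonneg ((by positivity : 0 ≤ c₁ * s ^ (2 * i + 3)).trans h1),
    Real.norm_of_nonneg hs0.le, inv_mul_eq_div, le_div_iff₀ hc₁]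
  linarith
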